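/- Let $R$ be a commutative Noetherian Cohen--Macaulay ring of Krull dimension $1$ (not necessarily local) which is generically Gorenstein, i.e. $R_{\mathfrak p}$ is a Gorenstein local ring for every associated prime $\mathfrak p$ of $R$. Let $Q(R)$ be the total ring of fractions of $R$, and let $R\subseteq S\subseteq Q(R)$ be a ring extension such that $S$ is a finitely generated $R$-module. All modules are finitely generated. For $A\in\{R,S\}$ let $\operatorname{refl}(A)$ be the class of reflexive $A$-modules (those for which the canonical map $M\to M^{**}$ is an isomorphism), let $\operatorname{CM}(A)$ be the class of maximal Cohen--Macaulay $A$-modules (those $N$ such that, for every maximal ideal $\mathfrak m$ of $A$, $N_{\mathfrak m}=0$ or $\operatorname{depth}_{A_{\mathfrak m}} N_{\mathfrak m}=\dim A_{\mathfrak m}$), and let $\Omega\operatorname{CM}(A)$ be the class of $A$-modules $M$ for which there is an exact sequence $0\to M\to P\to N\to 0$ of $A$-modules with $P$ projective and $N\in\operatorname{CM}(A)$. Let $\operatorname{tr}_R(M)=\sum_{f\in\operatorname{Hom}_R(M,R)}f(M)$ be the trace ideal of an $R$-module $M$ and let $\mathfrak c_R(S)=\{a\in Q(R): aS\subseteq R\}$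 be the conductor. Regard $S$-modules as $R$-modules by restriction of scalars. Then the following are equivalent: \begin{enumerate} \item $S\in\operatorname{refl}(R)$; \item $\Omega\operatorname{CM}(S)\subseteq\Omega\operatorname{CM}(R)$; \item $\operatorname{refl}(S)\subseteq\operatorname{refl}(R)$; \item $\operatorname{refl}(S)\subseteq\{M\in\operatorname{refl}(R):\operatorname{tr}_R(M)\subseteq\mathfrak c_R(S)\}$. \end{enumerate} -/

import Mathlib

universe u

namespace BirationalExt

/-- The depth of a module `M` over a local ring `A`: the supremum of the lengths of the
`M`-regular sequences contained in the maximal ideal. -/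
noncomputable def localDepth (A : Type u) [CommRing A] [IsLocalRing A]
    (M : Type u) [AddCommGroup M] [Module A M] : ℕ∞ :=
  ⨆ (rs : List A) (_ : ∀ r ∈ rs, r ∈ IsLocalRing.maximalIdeal A)
    (_ : RingTheory.Sequence.IsRegular M rs), (rs.length : ℕ∞)

/-- A Cohen-Macaulay ring: a Noetherian ring such that `depth A_m = dim A_m` for every
maximal ideal `m`. -/
def IsCohenMacaulayRing (A : Type u) [CommRing A] : Prop :=
  IsNoetherianRing A ∧ ∀ (m : Ideal A) [m.IsMaximal],
    ((localDepth (Localization.AtPrime m) (Localization.AtPrime m) : ℕ∞) : WithBot ℕ∞) =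
      ringKrullDim (Localization.AtPrime m)

/-- A Gorenstein local ring: a Noetherian local ring of finite injective dimension over itself. -/
def IsGorensteinLocalRing (A : Type u) [CommRing A] [IsLocalRing A] : Prop :=
  IsNoetherianRing A ∧
    ∃ n : ℕ, CategoryTheory.HasInjectiveDimensionLE (ModuleCat.of A A) n

/-- A Noetherian ring is generically Gorenstein if its localizations at all associated
prime ideals are Gorenstein. -/
def IsGenericallyGorenstein (A : Type u) [CommRing A] : Prop :=
  IsNoetherianRing A ∧ ∀ (p : Ideal A) [p.IsPrime], p ∈ associatedPrimes A A →
    IsGorensteinLocalRing (Localization.AtPrime p)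

/-- `M ∈ CM(A)`: the module `M` is finitely generated and maximal Cohen-Macaulay, i.e. for every
maximal ideal `m` of `A` either `M_m = 0` or `depth M_m = dim A_m`. -/
def IsMCM (A : Type u) [CommRing A] (M : Type u) [AddCommGroup M] [Module A M] : Prop :=
  Module.Finite A M ∧ ∀ (m : Ideal A) [m.IsMaximal],
    Subsingleton (LocalizedModule m.primeCompl M) ∨
      ((localDepth (Localization.AtPrime m) (LocalizedModule m.primeCompl M) : ℕ∞) :
        WithBot ℕ∞) = ringKrullDim (Localization.AtPrime m)

/-- `M ∈ refl(A)`: the module `M` is finitely generated and the canonical map `M → M**` is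
bijective. -/
def IsRefl (A : Type u) [CommRing A] (M : Type u) [AddCommGroup M] [Module A M] : Prop :=
  Module.Finite A M ∧ Module.IsReflexive A M

/-- `M ∈ ΩCM(A)`: the module `M` is finitely generated and there is an exact sequence
`0 → M → P → N → 0` with `P` finitely generated projective and `N` maximal Cohen-Macaulay. -/
def IsSyzygyOfMCM (A : Type u) [CommRing A] (M : Type u) [AddCommGroup M] [Module A M] : Prop :=
  Module.Finite A M ∧
    ∃ (P : Type u) (_ : AddCommGroup P) (_ : Module A P)
      (N : Type u) (_ : AddCommGroup N) (_ : Module A N) (f : M →ₗ[A] P) (g : P →ₗ[A] N),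
      Module.Finite A P ∧ Module.Projective A P ∧ IsMCM A N ∧
        Function.Injective f ∧ Function.Exact f g ∧ Function.Surjective g

/-- The trace ideal `tr_A(M)`: the sum of the images of all `A`-linear maps `M → A`. -/
def traceIdeal (A : Type u) [CommRing A] (M : Type u) [AddCommGroup M] [Module A M] : Ideal A :=
  ⨆ f : M →ₗ[A] A, LinearMap.range f

/-- The conductor `(R :_Q S) = {a ∈ Q | a S ⊆ R}` of a subalgebra `S` of `Q`; here
`1 : Submodule R Q` is the image of `R` in `Q`. -/
def conductorIn {R Q : Type u} [CommRing R] [CommRing Q] [Algebra R Q] (S : Subalgebra R Q) :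
    Submodule R Q :=
  1 / Subalgebra.toSubmodule S

end BirationalExt

/-!
Over a Cohen–Macaulay ring of dimension at most one, a finitely generated module is maximal
Cohen–Macaulay exactly when it is torsion-free. Hence reflexive modules and members of `ΩCM` alike
are kernels of surjections from projective modules onto torsion-free modules. The localizations of
`R` at its associated primes are Artinian Gorenstein, hence self-injective, so a functional on a
submodule `M ⊆ P` extends to `P` after multiplication by a nonzerodivisor; this forces `M` to be
reflexive as soon as `P` is reflexive and `P / M` is torsion-free. If `S` is reflexive over `R`, so
is every projective `S`-module, and this applies over `R` to syzygies over `S`. The trace condition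
is automatic: for `g : M → R` and `x : M`, the functional `s ↦ g (s x)` on `S` takes the value `g x`
at `1`, and the values at `1` of functionals on `S` make up the conductor.
-/

namespace BirationalExt

open IsLocalRing Module nonZeroDivisors

section LiftAlongSurjection

variable {A : Type u} [CommRing A] {E C : Type u} [AddCommGroup E] [Module A E]
  [AddCommGroup C] [Module A C]

theorem exists_comp_eq_of_injective_into_projective [Module.Injective A C] {g : E →ₗ[A] C}
    (hg : Function.Surjective g) {M F : Type u} [AddCommGroup M] [Module A M] [AddCommGroup F]
    [Module A F] [Module.Projective A F] (j : M →ₗ[A] F) (hj : Function.Injective j)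
    (φ : M →ₗ[A] C) : ∃ ψ : M →ₗ[A] E, g ∘ₗ ψ = φ := by
  obtain ⟨φ', rfl⟩ := Module.Injective.extension_property A C M F j hj φ
  obtain ⟨ψ, rfl⟩ := Module.projective_lifting_property g φ' hg
  exact ⟨ψ ∘ₗ j, rfl⟩

theorem exists_comp_eq_of_submodule_of_quotient [Module.Injective A E] (g : E →ₗ[A] C)
    {M : Type u} [AddCommGroup M] [Module A M] (N : Submodule A M)
    (hN : ∀ φ : N →ₗ[A] C, ∃ ψ : N →ₗ[A] E, g ∘ₗ ψ = φ)
    (hMN : ∀ φ : (M ⧸ N) →ₗ[A] C, ∃ ψ : (M ⧸ N) →ₗ[A] E, g ∘ₗ ψ = φ)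
    (φ : M →ₗ[A] C) : ∃ ψ : M →ₗ[A] E, g ∘ₗ ψ = φ := by
  obtain ⟨ψN, hψN⟩ := hN (φ ∘ₗ N.subtype)
  obtain ⟨ψ, rfl⟩ := Module.Injective.extension_property A E N M N.subtype N.injective_subtype ψN
  have hle : N ≤ LinearMap.ker (φ - g ∘ₗ ψ) := fun x hx ↦
    LinearMap.mem_ker.mpr (sub_eq_zero.mpr (LinearMap.congr_fun hψN ⟨x, hx⟩).symm)
  obtain ⟨χ, hχ⟩ := hMN (N.liftQ (φ - g ∘ₗ ψ) hle)
  refine ⟨ψ + χ ∘ₗ N.mkQ, ?_⟩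
  rw [LinearMap.comp_add, ← LinearMap.comp_assoc, hχ, N.liftQ_mkQ, add_sub_cancel]

end LiftAlongSurjection

section InjectiveDimension

open CategoryTheory

variable {A : Type u} [CommRing A] [IsArtinianRing A]

theorem exists_injective_of_isSimpleModule (V : Type*) [AddCommGroup V] [Module A V]
    [IsSimpleModule A V] : ∃ j : V →ₗ[A] A, Function.Injective j := by
  obtain ⟨m, hm, ⟨e⟩⟩ := isSimpleModule_iff_quot_maximal.mp ‹IsSimpleModule A V›
  have hass : m ∈ associatedPrimes A A := by
    refine Module.associatedPrimes.minimalPrimes_annihilator_subset_associatedPrimes A A ?_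
    rw [Module.annihilator_eq_bot.mpr inferInstance]
    exact Ideal.mem_minimalPrimes_of_krullDimLE_zero m
  obtain ⟨-, j, hj⟩ := (isAssociatedPrime_iff_exists_injective_linearMap m A).mp hass
  exact ⟨j ∘ₗ e, hj.comp e.injective⟩

theorem exists_injective_dfinsupp_of_isSemisimpleModule (V : Type u) [AddCommGroup V]
    [Module A V] [IsSemisimpleModule A V] :
    ∃ (ι : Type u) (j : V →ₗ[A] Π₀ _ : ι, A), Function.Injective j := by
  obtain ⟨s, e, -, hs⟩ := IsSemisimpleModule.exists_linearEquiv_dfinsupp A V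
  choose j hj using fun W : s ↦ exists_injective_of_isSimpleModule (A := A) W.1
  exact ⟨s, DFinsupp.mapRange.linearMap j ∘ₗ e,
    ((DFinsupp.mapRange_injective (fun W ↦ j W) fun W ↦ map_zero (j W)).mpr hj).comp e.injective⟩

/-- By dévissage it suffices to lift maps from semisimple modules, and these embed into free
modules because every simple module embeds into `A`. -/
theorem exists_comp_eq_of_isArtinianRing {E C : Type u} [AddCommGroup E] [Module A E]
    [AddCommGroup C] [Module A C] [Module.Injective A E] [Module.Injective A C] {g : E →ₗ[A] C}
    (hg : Function.Surjective g) (M : Type u) [AddCommGroup M] [Module A M] :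
    ∀ φ : M →ₗ[A] C, ∃ ψ : M →ₗ[A] E, g ∘ₗ ψ = φ := by
  refine IsSemiprimaryRing.induction ℤ A M
    (P := fun M ↦ ∀ φ : M →ₗ[A] C, ∃ ψ : M →ₗ[A] E, g ∘ₗ ψ = φ)
    (fun V _ _ _ _ _ _ ↦ ?_) fun M _ _ _ _ ↦ exists_comp_eq_of_submodule_of_quotient g _
  obtain ⟨ι, j, hj⟩ := exists_injective_dfinsupp_of_isSemisimpleModule (A := A) V
  exact exists_comp_eq_of_injective_into_projective hg j hj

theorem injective_of_injective_quotient_range {M E : Type u} [AddCommGroup M] [Module A M]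
    [AddCommGroup E] [Module A E] [Module.Injective A E] (f : M →ₗ[A] E)
    (hf : Function.Injective f) [Module.Injective A (E ⧸ LinearMap.range f)] :
    Module.Injective A M := by
  have hsection := exists_comp_eq_of_isArtinianRing (LinearMap.range f).mkQ_surjective
    (E ⧸ LinearMap.range f) LinearMap.id
  have hsplit := (LinearMap.exact_map_mkQ_range f).split_tfae'.out 0 1
  obtain ⟨-, r, hr⟩ := hsplit.mp ⟨hf, hsection⟩
  refine ⟨fun X Y _ _ _ _ i hi φ ↦ ?_⟩
  obtain ⟨h, hh⟩ := Module.Injective.extension_property A E X Y i hi (f ∘ₗ φ)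
  refine ⟨r ∘ₗ h, fun x ↦ ?_⟩
  rw [LinearMap.comp_apply, ← LinearMap.comp_apply h, hh, ← LinearMap.comp_apply,
    ← LinearMap.comp_assoc, hr, LinearMap.id_comp]

theorem injective_of_hasInjectiveDimensionLE {n : ℕ} {M : ModuleCat.{u} A}
    (hM : HasInjectiveDimensionLE M n) : Module.Injective A M := by
  induction n generalizing M with
  | zero =>
    exact (Module.injective_iff_injective_object A M).mpr
      (injective_iff_hasInjectiveDimensionLT_one.mpr hM)
  | succ n ih =>
    obtain ⟨E, _, f, _⟩ := EnoughInjectives.presentation M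
    have hf : Function.Injective f.hom := (ModuleCat.mono_iff_injective f).mp ‹_›
    have hexact := f.hom.exact_map_mkQ_range
    have hses := ModuleCat.shortComplex_shortExact
      (ModuleCat.shortComplexOfCompEqZero _ _ hexact.linearMap_comp_eq_zero)
      hexact hf (Submodule.mkQ_surjective _)
    have : Module.Injective A E := (Module.injective_iff_injective_object A E).mpr ‹_›
    have : Module.Injective A (E ⧸ LinearMap.range f.hom) :=
      ih ((hses.hasInjectiveDimensionLT_X₃_iff n ‹_›).mpr hM)
    exact injective_of_injective_quotient_range f.hom hf

end InjectiveDimension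

section KrullDimension

variable {R : Type*} [CommRing R]

theorem krullDimLE_of_isLocalization (n : ℕ) [Ring.KrullDimLE n R] (M : Submonoid R) (B : Type*)
    [CommRing B] [Algebra R B] [IsLocalization M B] : Ring.KrullDimLE n B := by
  have hmono : StrictMono (PrimeSpectrum.comap (algebraMap R B)) :=
    Monotone.strictMono_of_injective (fun _ _ h ↦ Ideal.comap_mono h)
      (PrimeSpectrum.localization_comap_injective B M)
  exact ⟨(Order.krullDim_le_of_strictMono _ hmono).trans Order.KrullDimLE.krullDim_le⟩

theorem krullDimLE_of_isIntegral (n : ℕ) [Ring.KrullDimLE n R] (B : Type*) [CommRing B]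
    [Algebra R B] [Algebra.IsIntegral R B] : Ring.KrullDimLE n B := by
  have hmono : StrictMono (PrimeSpectrum.comap (algebraMap R B)) := fun p q hpq ↦
    Ideal.IsIntegral.comap_lt_comap (I := p.asIdeal) (J := q.asIdeal) hpq
  exact ⟨(Order.krullDim_le_of_strictMono _ hmono).trans Order.KrullDimLE.krullDim_le⟩

theorem maximalIdeal_le_radical_span_singleton [IsLocalRing R] [Ring.KrullDimLE 1 R] {s : R}
    (hs : s ∈ R⁰) : maximalIdeal R ≤ (Ideal.span {s}).radical := by
  rw [Ideal.radical_eq_sInf]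
  refine le_sInf fun p ⟨hsp, hp⟩ ↦ ?_
  rcases Ring.krullDimLE_one_iff.mp ‹_› p hp with hmin | hmax
  · exact absurd hs (notMem_nonZeroDivisors_of_mem_mem_minimalPrimes
      (hsp (Ideal.mem_span_singleton_self s)) hmin)
  · exact (eq_maximalIdeal hmax).ge

theorem ringKrullDim_ne_zero_of_mem_maximalIdeal [IsLocalRing R] {s : R} (hs : s ∈ R⁰)
    (hsm : s ∈ maximalIdeal R) : ringKrullDim R ≠ 0 := fun h0 ↦ by
  have : Ring.KrullDimLE 0 R := ⟨h0.le⟩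
  exact notMem_nonZeroDivisors_of_mem_mem_minimalPrimes hsm
    (Ideal.mem_minimalPrimes_of_krullDimLE_zero (maximalIdeal R)) hs

end KrullDimension

section Depth

variable {A : Type u} [CommRing A] [IsLocalRing A] {M : Type u} [AddCommGroup M] [Module A M]

theorem exists_isSMulRegular_of_localDepth_ne_zero (h : localDepth A M ≠ 0) :
    ∃ t ∈ maximalIdeal A, IsSMulRegular M t := by
  by_contra! hc
  refine h (nonpos_iff_eq_zero.mp (iSup_le fun rs ↦ iSup_le fun hrs ↦ iSup_le fun hreg ↦ ?_))
  cases rs with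
  | nil => simp
  | cons t rs =>
    exact absurd ((RingTheory.Sequence.isRegular_cons_iff M t rs).mp hreg).1
      (hc t (hrs t List.mem_cons_self))

theorem localDepth_eq_zero_of_maximalIdeal_mem_associatedPrimes
    (h : maximalIdeal A ∈ associatedPrimes A M) : localDepth A M = 0 := by
  by_contra hne
  obtain ⟨t, ht, hreg⟩ := exists_isSMulRegular_of_localDepth_ne_zero hne
  obtain ⟨x, hx⟩ := h.eq_radical_colon
  obtain ⟨k, hk⟩ := hx ▸ ht
  have hx0 : x = 0 :=
    (hreg.pow k).right_eq_zero_of_smul (by simpa [Submodule.mem_colon_singleton] using hk)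
  exact h.isPrime.ne_top (by simp [hx, hx0])

theorem one_le_localDepth [Module.Finite A M] [Nontrivial M] {t : A} (ht : t ∈ maximalIdeal A)
    (hreg : IsSMulRegular M t) : 1 ≤ localDepth A M := by
  have hmem : ∀ r ∈ [t], r ∈ maximalIdeal A := by simpa using ht
  have hseq : RingTheory.Sequence.IsRegular M [t] :=
    .of_isWeaklyRegular_of_mem_maximalIdeal M hmem
      ((RingTheory.Sequence.isWeaklyRegular_singleton_iff M t).mpr hreg)
  exact le_iSup_of_le [t] (le_iSup_of_le hmem (le_iSup_of_le hseq (by simp)))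

theorem localDepth_le_ringKrullDim [IsNoetherianRing A] [Module.Finite A M] :
    (localDepth A M : WithBot ℕ∞) ≤ ringKrullDim A := by
  obtain ⟨d, hd⟩ := WithBot.ne_bot_iff_exists.mp (ringKrullDim_ne_bot (R := A))
  rw [← hd, WithBot.coe_le_coe]
  refine iSup_le fun rs ↦ iSup_le fun _ ↦ iSup_le fun hreg ↦ ?_
  have := hreg.quot_ofList_smul_nontrivial ⊤
  have := (Module.nonempty_support_of_nontrivial (R := A)
    (M := M ⧸ Ideal.ofList rs • (⊤ : Submodule A M))).to_subtype
  have hlength : (rs.length : WithBot ℕ∞) ≤ ringKrullDim A := calc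
    (rs.length : WithBot ℕ∞)
      ≤ Module.supportDim A (M ⧸ Ideal.ofList rs • (⊤ : Submodule A M)) + rs.length :=
        le_add_of_nonneg_left Order.krullDim_nonneg
    _ = Module.supportDim A M := Module.supportDim_add_length_eq_supportDim_of_isRegular rs hreg
    _ ≤ ringKrullDim A := Module.supportDim_le_ringKrullDim A M
  rw [← hd] at hlength
  exact_mod_cast hlength

theorem isSMulRegular_of_localDepth_eq_ringKrullDim [Ring.KrullDimLE 1 A]
    (hM : (localDepth A M : WithBot ℕ∞) = ringKrullDim A) {s : A} (hs : s ∈ A⁰) :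
    IsSMulRegular M s := by
  by_cases hsm : s ∈ maximalIdeal A
  · have hdepth : localDepth A M ≠ 0 := fun h0 ↦
      ringKrullDim_ne_zero_of_mem_maximalIdeal hs hsm (by rw [← hM, h0, WithBot.coe_zero])
    obtain ⟨t, ht, hreg⟩ := exists_isSMulRegular_of_localDepth_ne_zero hdepth
    obtain ⟨k, hk⟩ := maximalIdeal_le_radical_span_singleton hs ht
    obtain ⟨c, hc⟩ := Ideal.mem_span_singleton'.mp hk
    exact .of_mul (a := c) (hc ▸ hreg.pow k)
  · exact IsUnit.isSMulRegular M (notMem_maximalIdeal.mp hsm)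

end Depth

section MaximalCohenMacaulay

variable {R : Type u} [CommRing R]

theorem exists_mem_nonZeroDivisors_of_forall_not_le [IsNoetherianRing R] (I : Ideal R)
    (h : ∀ p ∈ associatedPrimes R R, ¬ I ≤ p) : ∃ t ∈ I, t ∈ R⁰ := by
  by_contra! hc
  have hsub : (I : Set R) ⊆ ⋃ p ∈ associatedPrimes R R, (p : Set R) := by
    rw [biUnion_associatedPrimes_eq_compl_nonZeroDivisors]
    exact hc
  obtain ⟨p, hp, hle⟩ := (Ideal.subset_union_prime_finite (associatedPrimes.finite R R)
    (f := id) ⊥ ⊥ fun p hp _ _ ↦ hp.isPrime).mp hsub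
  exact h p hp hle

theorem associatedPrimes_subset_minimalPrimes [Ring.KrullDimLE 1 R]
    (hCM : IsCohenMacaulayRing R) : associatedPrimes R R ⊆ minimalPrimes R := by
  intro p hp
  have := hp.isPrime
  rcases Ring.krullDimLE_one_iff.mp ‹_› p hp.isPrime with hmin | hmax
  · exact hmin
  have : IsNoetherianRing R := hCM.1
  have hass := Module.associatedPrimes.mem_associatedPrimes_atPrime_of_mem_associatedPrimes hp
  have hdim := hCM.2 p
  rw [localDepth_eq_zero_of_maximalIdeal_mem_associatedPrimes hass,
    IsLocalization.AtPrime.ringKrullDim_eq_height p] at hdim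
  exact Ideal.height_eq_zero_iff.mp (WithBot.coe_injective hdim).symm

theorem isArtinianRing_localization_of_mem_minimalPrimes [IsNoetherianRing R] {p : Ideal R}
    [p.IsPrime] (hp : p ∈ minimalPrimes R) : IsArtinianRing (Localization.AtPrime p) :=
  isArtinianRing_iff_isNoetherianRing_krullDimLE_zero.mpr
    ⟨IsLocalization.isNoetherianRing p.primeCompl _ ‹_›, .of_isLocalization p hp _⟩

theorem isMCM_of_isTorsionFree [Ring.KrullDimLE 1 R] (hCM : IsCohenMacaulayRing R)
    (N : Type u) [AddCommGroup N] [Module R N] [Module.Finite R N] [Module.IsTorsionFree R N] :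
    IsMCM R N := by
  have : IsNoetherianRing R := hCM.1
  refine ⟨‹_›, fun m hm ↦ or_iff_not_imp_left.mpr fun hN ↦ ?_⟩
  have : Nontrivial (LocalizedModule m.primeCompl N) := not_subsingleton_iff_nontrivial.mp hN
  have : IsNoetherianRing (Localization.AtPrime m) :=
    IsLocalization.isNoetherianRing m.primeCompl _ ‹_›
  have := krullDimLE_of_isLocalization 1 m.primeCompl (Localization.AtPrime m)
  refine le_antisymm localDepth_le_ringKrullDim ?_
  by_cases hass : m ∈ associatedPrimes R R
  · have hheight := Ideal.height_eq_zero_iff.mpr (associatedPrimes_subset_minimalPrimes hCM hass)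
    rw [IsLocalization.AtPrime.ringKrullDim_eq_height m, hheight]
    exact WithBot.coe_le_coe.mpr zero_le
  · obtain ⟨s, hsm, hs⟩ := exists_mem_nonZeroDivisors_of_forall_not_le m fun p hp hle ↦
      hass (hm.eq_of_le hp.isPrime.ne_top hle ▸ hp)
    have hreg : IsSMulRegular (LocalizedModule m.primeCompl N)
        (algebraMap R (Localization.AtPrime m) s) :=
      (isRegular_iff_mem_nonZeroDivisors.mpr hs).isSMulRegular.of_isLocalizedModule
        (Localization.AtPrime m) m.primeCompl (LocalizedModule.mkLinearMap m.primeCompl N)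
    have hdepth := one_le_localDepth
      ((IsLocalization.AtPrime.to_map_mem_maximal_iff _ m s).mpr hsm) hreg
    exact Order.KrullDimLE.krullDim_le.trans (WithBot.coe_le_coe.mpr hdepth)

theorem isTorsionFree_of_isMCM [Ring.KrullDimLE 1 R] {N : Type u} [AddCommGroup N] [Module R N]
    (hN : IsMCM R N) : Module.IsTorsionFree R N := by
  refine ⟨fun s hs ↦ isSMulRegular_iff_right_eq_zero_of_smul.mpr fun x hx ↦ ?_⟩
  refine Module.eq_zero_of_localization_maximal
    (fun (m : Ideal R) _ ↦ LocalizedModule m.primeCompl N)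
    (fun (m : Ideal R) _ ↦ LocalizedModule.mkLinearMap m.primeCompl N) x fun m hm ↦ ?_
  rcases hN.2 m with hsub | hdepth
  · exact Subsingleton.elim _ _
  have := krullDimLE_of_isLocalization 1 m.primeCompl (Localization.AtPrime m)
  have hs' : algebraMap R (Localization.AtPrime m) s ∈ (Localization.AtPrime m)⁰ :=
    IsLocalization.map_nonZeroDivisors_le m.primeCompl _
      (Submonoid.mem_map_of_mem _ (isRegular_iff_mem_nonZeroDivisors.mp hs))
  refine (isSMulRegular_of_localDepth_eq_ringKrullDim hdepth hs').right_eq_zero_of_smul ?_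
  rw [algebraMap_smul, ← map_smul, hx, map_zero]

end MaximalCohenMacaulay

section GenericExtension

variable {R : Type u} [CommRing R] {M P : Type u} [AddCommGroup M] [Module R M]
  [AddCommGroup P] [Module R P]

theorem exists_comp_eq_smul_of_isLocalizedModule (W : Submonoid R) {N N' : Type u}
    [AddCommGroup N] [Module R N] [AddCommGroup N'] [Module R N'] [Module (Localization W) N']
    [IsScalarTower R (Localization W) N'] (l : N →ₗ[R] N') [IsLocalizedModule W l]
    [Module.Injective (Localization W) N'] [Module.Finite R M] [FinitePresentation R P]
    (f : M →ₗ[R] P) (hf : Function.Injective f) (φ : M →ₗ[R] N) :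
    ∃ t ∈ W, ∃ g : P →ₗ[R] N, g ∘ₗ f = t • φ := by
  let φ' := IsLocalizedModule.mapExtendScalars W (LocalizedModule.mkLinearMap W M) l
    (Localization W) φ
  obtain ⟨h, hh⟩ := Module.Injective.extension_property (Localization W) N' _ _
    (LocalizedModule.map W f) (LocalizedModule.map_injective W f hf) φ'
  let h' : P →ₗ[R] N' := h.restrictScalars R ∘ₗ LocalizedModule.mkLinearMap W P
  have hh' : h' ∘ₗ f = l ∘ₗ φ := by
    ext x
    have hx := LinearMap.congr_fun hh (LocalizedModule.mkLinearMap W M x)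
    rw [LinearMap.comp_apply l, ← IsLocalizedModule.map_apply W (LocalizedModule.mkLinearMap W M)]
    simpa [h', φ', LocalizedModule.map_mk] using hx
  obtain ⟨g, s, hs⟩ := FinitePresentation.exists_lift_of_isLocalizedModule W l h'
  have hcomp : l ∘ₗ (g ∘ₗ f) = l ∘ₗ (s.1 • φ) := by
    rw [← LinearMap.comp_assoc, hs, LinearMap.smul_comp, hh', LinearMap.comp_smul]
    rfl
  obtain ⟨u, hu⟩ := Module.Finite.exists_smul_of_comp_eq_of_isLocalizedModule W l
    (g ∘ₗ f) (s.1 • φ) hcomp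
  exact ⟨u * s, (u * s).2, u.1 • g, by rw [LinearMap.smul_comp, mul_smul]; exact hu⟩

/-- `R` is self-injective at its associated primes; for Noetherian `R` this says that the total
ring of fractions of `R` is self-injective. -/
def IsGenericallySelfInjective (R : Type u) [CommRing R] : Prop :=
  ∀ (p : Ideal R) [p.IsPrime], p ∈ associatedPrimes R R →
    Module.Injective (Localization.AtPrime p) (Localization.AtPrime p)

theorem IsGenericallySelfInjective.exists_comp_eq_smul [IsNoetherianRing R] [Module.Finite R M]
    [Module.Finite R P] (hR : IsGenericallySelfInjective R) (f : M →ₗ[R] P)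
    (hf : Function.Injective f) (φ : Dual R M) : ∃ t ∈ R⁰, ∃ g : Dual R P, g ∘ₗ f = t • φ := by
  let J : Ideal R := (LinearMap.range f.dualMap).comap (LinearMap.toSpanSingleton R (Dual R M) φ)
  obtain ⟨t, htJ, ht⟩ : ∃ t ∈ J, t ∈ R⁰ :=
    exists_mem_nonZeroDivisors_of_forall_not_le J fun p hp hle ↦ by
      have := hp.isPrime
      have := hR p hp
      have := finitePresentation_of_finite R P
      obtain ⟨t, htp, hg⟩ := exists_comp_eq_smul_of_isLocalizedModule p.primeCompl
        (Algebra.linearMap R (Localization.AtPrime p)) f hf φ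
      exact htp (hle hg)
  exact ⟨t, ht, htJ⟩

theorem IsGenericallySelfInjective.exists_dual_ne_zero [IsNoetherianRing R] [Module.Finite R P]
    [IsTorsionFree R P] (hR : IsGenericallySelfInjective R) {x : P} (hx : x ≠ 0) :
    ∃ g : Dual R P, g x ≠ 0 := by
  let I : Ideal R := LinearMap.ker (LinearMap.toSpanSingleton R P x)
  have hI : Disjoint (I : Set R) (R⁰ : Set R) := Set.disjoint_left.mpr fun t htI ht ↦
    hx ((isRegular_iff_mem_nonZeroDivisors.mpr ht).isSMulRegular.right_eq_zero_of_smul htI)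
  obtain ⟨r, hrI, hr⟩ := Submodule.exists_mem_ne_zero_of_ne_bot
    (Ideal.bot_lt_annihilator_of_disjoint_nonZeroDivisors hI).ne'
  have hle : I ≤ LinearMap.ker (LinearMap.toSpanSingleton R R r) := fun a ha ↦ by
    have := Submodule.mem_annihilator.mp hrI a ha
    simpa [mul_comm] using this
  obtain ⟨t, ht, g, hg⟩ := hR.exists_comp_eq_smul (I.liftQ _ le_rfl)
    (LinearMap.ker_eq_bot.mp (Submodule.ker_liftQ_eq_bot _ _ _ le_rfl)) (I.liftQ _ hle)
  have hgx : g x = t * r := by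
    simpa only [LinearMap.comp_apply, Submodule.mkQ_apply, Submodule.liftQ_apply,
      LinearMap.toSpanSingleton_apply, LinearMap.smul_apply, one_smul, smul_eq_mul, one_mul]
      using LinearMap.congr_fun hg (I.mkQ 1)
  exact ⟨g, by rwa [hgx, Ne, mul_left_mem_nonZeroDivisors_eq_zero_iff ht]⟩

theorem IsGenericallySelfInjective.isReflexive [IsNoetherianRing R] [Module.Finite R P]
    [IsReflexive R P] (hR : IsGenericallySelfInjective R) (f : M →ₗ[R] P)
    (hf : Function.Injective f) [IsTorsionFree R (P ⧸ LinearMap.range f)] : IsReflexive R M := by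
  have : Module.Finite R M := Module.Finite.of_injective f hf
  refine ⟨fun x y hxy ↦ hf ((bijective_dual_eval R P).1 ?_), fun α ↦ ?_⟩
  · ext g
    exact LinearMap.congr_fun hxy (g ∘ₗ f)
  obtain ⟨q, hq⟩ := (bijective_dual_eval R P).2 (f.dualMap.dualMap α)
  have hαq (g : Dual R P) : α (g ∘ₗ f) = g q := (LinearMap.congr_fun hq g).symm
  have hmem : q ∈ LinearMap.range f := by
    by_contra hq0
    obtain ⟨g, hg⟩ := hR.exists_dual_ne_zero (x := (LinearMap.range f).mkQ q) (by simpa using hq0)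
    refine hg ((hαq (g ∘ₗ (LinearMap.range f).mkQ)).symm.trans ?_)
    rw [LinearMap.comp_assoc, LinearMap.range_mkQ_comp, LinearMap.comp_zero, map_zero]
  obtain ⟨x, rfl⟩ := hmem
  refine ⟨x, LinearMap.ext fun φ ↦ ?_⟩
  obtain ⟨t, ht, g, hg⟩ := hR.exists_comp_eq_smul f hf φ
  have htα : t * φ x = t * α φ := calc
    t * φ x = (g ∘ₗ f) x := (LinearMap.congr_fun hg x).symm
    _ = α (g ∘ₗ f) := (hαq g).symm
    _ = t * α φ := by rw [hg, map_smul, smul_eq_mul]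
  exact (isRegular_iff_mem_nonZeroDivisors.mpr ht).left htα

theorem IsGenericallyGorenstein.isGenericallySelfInjective [Ring.KrullDimLE 1 R]
    (hG : IsGenericallyGorenstein R) (hCM : IsCohenMacaulayRing R) :
    IsGenericallySelfInjective R := by
  intro p _ hp
  have : IsNoetherianRing R := hCM.1
  have := isArtinianRing_localization_of_mem_minimalPrimes
    (associatedPrimes_subset_minimalPrimes hCM hp)
  obtain ⟨-, n, hn⟩ := hG.2 p hp
  exact injective_of_hasInjectiveDimensionLE hn

end GenericExtension

section TorsionFreeSyzygy

variable {A : Type u} [CommRing A] {M : Type u} [AddCommGroup M] [Module A M]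

/-- `M` is the kernel of a surjection from a finitely generated projective module onto a
torsion-free module. In dimension at most one this is the form in which both reflexivity and
membership in `ΩCM` are used. -/
def IsTorsionFreeSyzygy (A : Type u) [CommRing A] (M : Type u) [AddCommGroup M] [Module A M] :
    Prop :=
  ∃ (P : Type u) (_ : AddCommGroup P) (_ : Module A P) (f : M →ₗ[A] P),
    Module.Finite A P ∧ Module.Projective A P ∧ Function.Injective f ∧
      IsTorsionFree A (P ⧸ LinearMap.range f)

theorem isTorsionFree_dual_quotient_range_dualMap {F N : Type*} [AddCommGroup F] [Module A F]
    [AddCommGroup N] [Module A N] (π : F →ₗ[A] N) (hπ : Function.Surjective π) :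
    IsTorsionFree A (Dual A F ⧸ LinearMap.range π.dualMap) := by
  refine ⟨fun t ht ↦ ?_⟩
  rw [LinearMap.range_dualMap_eq_dualAnnihilator_ker_of_surjective π hπ,
    isSMulRegular_quotient_iff_mem_of_smul_mem]
  intro ψ hψ
  rw [Submodule.mem_dualAnnihilator] at hψ ⊢
  exact fun y hy ↦ ht.left.mul_left_eq_zero_iff.mp (hψ y hy)

theorem isTorsionFreeSyzygy_of_isReflexive [IsNoetherianRing A] [Module.Finite A M]
    [IsReflexive A M] : IsTorsionFreeSyzygy A M := by
  obtain ⟨n, π, hπ⟩ := Module.Finite.exists_fin' A (Dual A M)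
  have hrange : LinearMap.range (π.dualMap ∘ₗ Dual.eval A M) = LinearMap.range π.dualMap :=
    LinearMap.range_comp_of_range_eq_top _ (LinearMap.range_eq_top.mpr (bijective_dual_eval A M).2)
  refine ⟨_, _, _, π.dualMap ∘ₗ Dual.eval A M, inferInstance, inferInstance,
    (LinearMap.dualMap_injective_of_surjective hπ).comp (bijective_dual_eval A M).1, ?_⟩
  rw [hrange]
  exact isTorsionFree_dual_quotient_range_dualMap π hπ

theorem IsSyzygyOfMCM.isTorsionFreeSyzygy [Ring.KrullDimLE 1 A] (hM : IsSyzygyOfMCM A M) :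
    IsTorsionFreeSyzygy A M := by
  obtain ⟨-, P, _, _, N, _, _, f, g, hfin, hproj, hN, hf, hfg, hg⟩ := hM
  have := isTorsionFree_of_isMCM hN
  have e : (P ⧸ LinearMap.range f) ≃ₗ[A] N := hfg.linearEquivOfSurjective hg
  exact ⟨P, _, _, f, hfin, hproj, hf, e.injective.moduleIsTorsionFree e (map_smul e)⟩

theorem IsTorsionFreeSyzygy.isSyzygyOfMCM [Ring.KrullDimLE 1 A] [Module.Finite A M]
    (hCM : IsCohenMacaulayRing A) (hM : IsTorsionFreeSyzygy A M) : IsSyzygyOfMCM A M := by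
  obtain ⟨P, _, _, f, _, _, hf, _⟩ := hM
  exact ⟨‹_›, P, _, _, _, _, _, f, (LinearMap.range f).mkQ, ‹_›, ‹_›,
    isMCM_of_isTorsionFree hCM _, hf, LinearMap.exact_map_mkQ_range f, Submodule.mkQ_surjective _⟩

theorem isSyzygyOfMCM_self : IsSyzygyOfMCM A A :=
  ⟨inferInstance, A, _, _, PUnit, _, _, LinearMap.id, 0, inferInstance, inferInstance,
    ⟨inferInstance, fun _ _ ↦ .inl inferInstance⟩, Function.injective_id,
    fun x ↦ by simp, fun x ↦ ⟨0, rfl⟩⟩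

end TorsionFreeSyzygy

section FiniteAlgebra

variable {R S : Type u} [CommRing R] [CommRing S] [Algebra R S]

theorem isReflexive_of_projective [IsReflexive R S] (P : Type*) [AddCommGroup P] [Module S P]
    [Module R P] [IsScalarTower R S P] [Module.Finite S P] [Module.Projective S P] :
    IsReflexive R P := by
  obtain ⟨n, f, g, -, -, hfg⟩ := Module.Finite.exists_comp_eq_id_of_projective S P
  have : IsReflexive R (Fin n → S) := by
    clear hfg f g
    induction n with
    | zero => infer_instance
    | succ n ih => exact Module.equiv (Fin.consLinearEquiv R fun _ : Fin (n + 1) ↦ S)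
  exact .of_split (g.restrictScalars R) (f.restrictScalars R)
    (LinearMap.ext fun x ↦ LinearMap.congr_fun hfg x)

theorem IsTorsionFreeSyzygy.isReflexive [IsNoetherianRing R] [Module.Finite R S]
    [IsReflexive R S] (hR : IsGenericallySelfInjective R) {M : Type u} [AddCommGroup M]
    [Module S M] [Module R M] [IsScalarTower R S M] (hM : IsTorsionFreeSyzygy S M) :
    IsReflexive R M := by
  obtain ⟨P, _, _, f, _, _, hf, _⟩ := hM
  let : Module R P := Module.compHom P (algebraMap R S)
  have : IsScalarTower R S P := .of_compHom R S P
  have : Module.Finite R P := Module.Finite.trans S P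
  have : IsReflexive R P := isReflexive_of_projective (S := S) P
  have : IsTorsionFree R (P ⧸ LinearMap.range f) := .trans S
  have : IsTorsionFree R (P ⧸ LinearMap.range (f.restrictScalars R)) := this
  exact hR.isReflexive (f.restrictScalars R) hf

/-- The image of the evaluation `Hom_R(S, R) → R` at `1`. When `S` is contained in the total ring
of fractions of `R`, this is the conductor `c_R(S)`, which is contained in `R` because `1 ∈ S`. -/
def conductorIdeal (R S : Type u) [CommRing R] [CommRing S] [Algebra R S] : Ideal R :=
  LinearMap.range (Dual.eval R S 1)

theorem traceIdeal_le_conductorIdeal (M : Type u) [AddCommGroup M] [Module S M] [Module R M]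
    [IsScalarTower R S M] : traceIdeal R M ≤ conductorIdeal R S := by
  refine iSup_le fun g ↦ ?_
  rintro _ ⟨x, rfl⟩
  exact ⟨g ∘ₗ (LinearMap.toSpanSingleton S M x).restrictScalars R, by simp⟩

end FiniteAlgebra

section Conductor

variable {R Q : Type u} [CommRing R] [CommRing Q] [Algebra R Q] [IsFractionRing R Q]

theorem algebraMap_dual_apply (S : Subalgebra R Q) (φ : Dual R S) (s : S) :
    algebraMap R Q (φ s) = s * algebraMap R Q (φ 1) := by
  obtain ⟨⟨r, t⟩, hrt⟩ := IsLocalization.surj R⁰ (s : Q)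
  have hts : t.1 • s = r • (1 : S) := by
    ext
    simpa [Algebra.smul_def, mul_comm] using hrt
  have hφ : t.1 * φ s = r * φ 1 := by
    simpa only [map_smul, smul_eq_mul] using congrArg φ hts
  refine (IsLocalization.map_units Q t).mul_left_cancel ?_
  rw [← map_mul, hφ, map_mul, ← mul_assoc, mul_comm _ (s : Q), hrt]

theorem map_conductorIdeal (S : Subalgebra R Q) :
    Submodule.map (Algebra.linearMap R Q) (conductorIdeal R S) = conductorIn S := by
  refine le_antisymm ?_ fun a ha ↦ ?_
  · rintro _ ⟨_, ⟨φ, rfl⟩, rfl⟩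
    refine Submodule.mem_div_iff_forall_mul_mem.mpr fun s hs ↦ Submodule.mem_one.mpr ⟨φ ⟨s, hs⟩, ?_⟩
    rw [algebraMap_dual_apply, mul_comm]
    rfl
  · let ι := LinearEquiv.ofInjective (Algebra.linearMap R Q) (IsFractionRing.injective R Q)
    have haS (s : S) : a * s ∈ LinearMap.range (Algebra.linearMap R Q) := by
      rw [← Submodule.one_eq_range]
      exact Submodule.mem_div_iff_forall_mul_mem.mp ha s s.2
    let mulA : S →ₗ[R] LinearMap.range (Algebra.linearMap R Q) :=
      (LinearMap.mulLeft R a ∘ₗ S.val.toLinearMap).codRestrict _ haS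
    refine ⟨_, ⟨ι.symm.toLinearMap ∘ₗ mulA, rfl⟩, ?_⟩
    calc Algebra.linearMap R Q (ι.symm (mulA 1))
      _ = mulA 1 := congrArg Subtype.val (ι.apply_symm_apply (mulA 1))
      _ = a := mul_one a

end Conductor

theorem proposition2p6_general {R S : Type u} [CommRing R] [CommRing S] [Algebra R S]
    [Module.Finite R S] [Ring.KrullDimLE 1 R] (hCM : IsCohenMacaulayRing R)
    (hG : IsGenericallyGorenstein R) :
    List.TFAE [
      IsRefl R S,
      ∀ (M : Type u) [AddCommGroup M] [Module S M] [Module R M] [IsScalarTower R S M],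
        IsSyzygyOfMCM S M → IsSyzygyOfMCM R M,
      ∀ (M : Type u) [AddCommGroup M] [Module S M] [Module R M] [IsScalarTower R S M],
        IsRefl S M → IsRefl R M,
      ∀ (M : Type u) [AddCommGroup M] [Module S M] [Module R M] [IsScalarTower R S M],
        IsRefl S M → IsRefl R M ∧ traceIdeal R M ≤ conductorIdeal R S] := by
  have : IsNoetherianRing R := hCM.1
  have : IsNoetherianRing S := IsNoetherianRing.of_finite R S
  have : Ring.KrullDimLE 1 S := krullDimLE_of_isIntegral 1 (R := R) S
  have hR := hG.isGenericallySelfInjective hCM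
  tfae_have 1 → 2 := by
    intro ⟨_, _⟩ M _ _ _ _ hM
    have := hM.1
    have : Module.Finite R M := Module.Finite.trans S M
    have := hM.isTorsionFreeSyzygy.isReflexive hR
    exact isTorsionFreeSyzygy_of_isReflexive.isSyzygyOfMCM hCM
  tfae_have 2 → 1 := fun h ↦
    ⟨‹_›, (h S (isSyzygyOfMCM_self)).isTorsionFreeSyzygy.isReflexive hR⟩
  tfae_have 1 → 3 := by
    intro ⟨_, _⟩ M _ _ _ _ ⟨_, _⟩
    exact ⟨Module.Finite.trans S M,
      (isTorsionFreeSyzygy_of_isReflexive (A := S)).isReflexive hR⟩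
  tfae_have 3 → 1 := fun h ↦ h S ⟨inferInstance, inferInstance⟩
  tfae_have 3 → 4 := fun h M _ _ _ _ hM ↦ ⟨h M hM, traceIdeal_le_conductorIdeal M⟩
  tfae_have 4 → 3 := fun h M _ _ _ _ hM ↦ (h M hM).1
  tfae_finish

end BirationalExt

theorem proposition2p6 {R Q : Type u} [CommRing R] [CommRing Q] [Algebra R Q]
    [IsFractionRing R Q]
    (hCM : BirationalExt.IsCohenMacaulayRing R) (hdim : ringKrullDim R = 1)
    (hG : BirationalExt.IsGenericallyGorenstein R)
    (S : Subalgebra R Q) (hS : Module.Finite R S) :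
    List.TFAE [
      BirationalExt.IsRefl R S,
      ∀ (M : Type u) [AddCommGroup M] [Module S M] [Module R M] [IsScalarTower R S M],
        BirationalExt.IsSyzygyOfMCM S M → BirationalExt.IsSyzygyOfMCM R M,
      ∀ (M : Type u) [AddCommGroup M] [Module S M] [Module R M] [IsScalarTower R S M],
        BirationalExt.IsRefl S M → BirationalExt.IsRefl R M,
      ∀ (M : Type u) [AddCommGroup M] [Module S M] [Module R M] [IsScalarTower R S M],
        BirationalExt.IsRefl S M →
          BirationalExt.IsRefl R M ∧
            Submodule.map (Algebra.linearMap R Q) (BirationalExt.traceIdeal R M) ≤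
              BirationalExt.conductorIn S] := by
  have : Ring.KrullDimLE 1 R := ⟨hdim.le⟩
  simpa only [← BirationalExt.map_conductorIdeal,
    Submodule.map_le_map_iff_of_injective (f := Algebra.linearMap R Q)
      (IsFractionRing.injective R Q)]
    using BirationalExt.proposition2p6_general (S := S) hCM hG
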